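/- Let $d\ge 1$, $m>0$, $\beta\ge 0$, $0<c_1\le c_2<\infty$ and $\eta:\mathbb S^{d-1}\to[c_1,c_2]$. Let $f\ge 0$ be a Lebesgue measurable function on $\mathbb R^d$ with $$f(x)=\eta\!\left(\frac{x}{|x|}\right)e^{-m|x|}(1\vee|x|)^{-\beta},\qquad x\neq 0.$$ For $\theta\in\mathbb S^{d-1}$ and $\gamma\ge 0$, say that a function $f\in L^1(\mathbb R^d)$ with $f\ge0$ and $f(t\theta)>0$ for all sufficiently large $t$ belongs to the class $\mathscr S_d(\theta,\gamma)$ if $$\lim_{t\to\infty}\frac{f(t\theta-y)}{f(t\theta)}=e^{\gamma(\theta\cdot y)}\ \text{ for every } y\in\mathbb R^d,\qquad h(\theta):=\int_{\mathbb R^d}e^{\gamma(\theta\cdot y)}f(y)\,dy<\infty,\qquad \lim_{t\to\infty}\frac{(f*f)(t\theta)}{f(t\theta)}=2h(\theta),$$ where $(f*f)(x)=\int_{\mathbb R^d} f(x-y)f(y)\,dy$. For $r>0$ put $$K_f(r):=\sup_{|x|\ge 1}\int_{|x-y|>r,\ |y|>r}\frac{f(x-y)f(y)}{f(x)}\,dy\in[0,\infty].$$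 Then the following hold. (i) If $\theta\in\mathbb S^{d-1}$ is such that $\eta\big((t\theta-y)/|t\theta-y|\big)\to\eta(\theta)$ as $t\to\infty$ for every $y\in\mathbb R^d$, then $$f\in\mathscr S_d(\theta,m)\iff \beta>\frac{d+1}{2}.$$ (ii) If $\beta>\frac{d+1}{2}$, there is a constant $c\ge 1$ such that $c^{-1}r^{\frac{d+1}{2}-\beta}\le K_f(r)\le c\,r^{\frac{d+1}{2}-\beta}$ for all $r>1$. (iii) If $0\le\beta\le\frac{d+1}{2}$, then $K_f(r)=\infty$ for every $r>1$. -/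

import Mathlib

open MeasureTheory Filter Topology
open scoped ENNReal

noncomputable section

/-- The twofold convolution `∫ f (x - y) f y dy` of a nonnegative function, with values in `[0, ∞]`. -/
def convSq {d : ℕ} (f : EuclideanSpace ℝ (Fin d) → ℝ) (x : EuclideanSpace ℝ (Fin d)) : ℝ≥0∞ :=
  ∫⁻ y, ENNReal.ofReal (f (x - y) * f y)

/-- The directional exponential moment `h(θ) = ∫ exp (γ (θ · y)) f y dy`, with values in `[0, ∞]`. -/
def dirExpMoment {d : ℕ} (f : EuclideanSpace ℝ (Fin d) → ℝ) (θ : EuclideanSpace ℝ (Fin d))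
    (γ : ℝ) : ℝ≥0∞ :=
  ∫⁻ y, ENNReal.ofReal (Real.exp (γ * inner ℝ θ y) * f y)

/-- The class of convolution equivalent densities on `ℝ^d` with parameter `γ` in the
direction `θ`. The last limit is taken in `[0, ∞]`, where its value `2 h(θ)` is finite. -/
structure MemConvEquiv {d : ℕ} (θ : EuclideanSpace ℝ (Fin d)) (γ : ℝ)
    (f : EuclideanSpace ℝ (Fin d) → ℝ) : Prop where
  norm_eq_one : ‖θ‖ = 1
  gamma_nonneg : 0 ≤ γ
  nonneg : ∀ x, 0 ≤ f x
  integrable : Integrable f volume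
  pos_on_ray : ∃ t₀ : ℝ, 0 < t₀ ∧ ∀ t : ℝ, t₀ ≤ t → 0 < f (t • θ)
  tendsto_shift : ∀ y : EuclideanSpace ℝ (Fin d),
    Tendsto (fun t : ℝ => f (t • θ - y) / f (t • θ)) atTop (𝓝 (Real.exp (γ * inner ℝ θ y)))
  moment_lt_top : dirExpMoment f θ γ < ∞
  tendsto_conv : Tendsto (fun t : ℝ => convSq f (t • θ) / ENNReal.ofReal (f (t • θ))) atTop
    (𝓝 (2 * dirExpMoment f θ γ))

/-- `K_f(r)`, the supremum over `|x| ≥ 1` of the integral of `f (x - y) f y / f x` over the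
set of those `y` for which `|x - y| > r` and `|y| > r`; values in `[0, ∞]`. -/
def convK {d : ℕ} (f : EuclideanSpace ℝ (Fin d) → ℝ) (r : ℝ) : ℝ≥0∞ :=
  ⨆ (x : EuclideanSpace ℝ (Fin d)) (_ : 1 ≤ ‖x‖),
    ∫⁻ y in {y : EuclideanSpace ℝ (Fin d) | r < ‖x - y‖ ∧ r < ‖y‖},
      ENNReal.ofReal (f (x - y) * f y) / ENNReal.ofReal (f x)

/-- The profile `g(s) = exp (-m s) (1 ∨ s)^(-β)`. -/
def expProfile (m β s : ℝ) : ℝ := Real.exp (-m * s) * (max 1 s) ^ (-β)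

end

/-! Everything reduces to the tilted weight `exp (-m (|y| - u·y))`. At distance about `s` along the
ray of `u` it is bounded below on a paraboloid of transverse width `√s`, and transversally it decays
like a Gaussian of that width. So the scale `s` carries mass of order `s · s^((d-1)/2) =
s^((d+1)/2)`; with the factor `|y|^(-β)` a dyadic shell contributes about `s^((d+1)/2-β)`. Summed
over `s = 2^k r`, this converges exactly when `β > (d+1)/2`, and then has order `r^((d+1)/2-β)`.

The convolution inherits these bounds. Where `|y| ≤ |x-y|`, the ratio `f(x-y)/f(x)` is at most a
constant times `exp (m u·y)` with `u = x/|x|` (`div_le_of_norm_le`), and `y ↦ x - y` covers the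
other half. On paraboloids well inside the segment from `0` to `x` the reverse bound holds
(`le_div_of_mem_parabolicRegion`). The limit in (i) is dominated convergence on the two halves, each
yielding `h(θ)`; its failure for small `β` is the divergence of `h(θ)`.

With `d = n + 1`, the critical exponent is written `(n + 2) / 2`. -/

/-! ### Volume and exponential integrals near a ray. -/

/-- The reflection exchanging `u` and `v` preserves norm and volume. It moves any direction to a
coordinate axis, where integrals factor. -/
theorem lintegral_norm_inner_eq {n : ℕ} {u v : EuclideanSpace ℝ (Fin n)} (hu : ‖u‖ = 1)
    (hv : ‖v‖ = 1) (G : ℝ → ℝ → ℝ≥0∞) :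
    ∫⁻ y : EuclideanSpace ℝ (Fin n), G ‖y‖ (inner ℝ u y) =
      ∫⁻ y : EuclideanSpace ℝ (Fin n), G ‖y‖ (inner ℝ v y) := by
  let L := (ℝ ∙ (u - v))ᗮ.reflection
  have hL : L u = v := Submodule.reflection_sub (by rw [hu, hv])
  rw [← L.measurePreserving.lintegral_comp_emb L.toHomeomorph.measurableEmbedding
    fun y => G ‖y‖ (inner ℝ v y)]
  refine lintegral_congr fun y => ?_
  rw [L.norm_map, ← hL, L.inner_map_map]

theorem lintegral_euclidean_eq_pi {n : ℕ} (G : EuclideanSpace ℝ (Fin n) → ℝ≥0∞) :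
    ∫⁻ y, G y = ∫⁻ z : Fin n → ℝ, G (WithLp.toLp 2 z) :=
  ((PiLp.volume_preserving_toLp (Fin n)).lintegral_comp_emb
    (MeasurableEquiv.toLp 2 (Fin n → ℝ)).measurableEmbedding G).symm

/-- A parabolic region around the ray in direction `u`, at distance about `s` from the origin. -/
def parabolicRegion {n : ℕ} (u : EuclideanSpace ℝ (Fin n)) (s : ℝ) :
    Set (EuclideanSpace ℝ (Fin n)) :=
  {y | s < inner ℝ u y ∧ inner ℝ u y < 2 * s ∧ ‖y‖ ^ 2 - (inner ℝ u y) ^ 2 ≤ s}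

theorem measurableSet_parabolicRegion {n : ℕ} (u : EuclideanSpace ℝ (Fin n)) (s : ℝ) :
    MeasurableSet (parabolicRegion u s) := by
  unfold parabolicRegion
  measurability

theorem exists_le_volume_parabolicRegion (n : ℕ) : ∃ c : ℝ, 0 < c ∧
    ∀ (u : EuclideanSpace ℝ (Fin (n + 1))), ‖u‖ = 1 → ∀ s : ℝ, 0 < s →
      ENNReal.ofReal (c * s ^ (((n : ℝ) + 2) / 2)) ≤ volume (parabolicRegion u s) := by
  set e : EuclideanSpace ℝ (Fin (n + 1)) := EuclideanSpace.single 0 1 with he_def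
  have he : ‖e‖ = 1 := by simp [he_def]
  refine ⟨(2 / √((n : ℝ) + 1)) ^ n, by positivity, fun u hu s hs => ?_⟩
  have hvol : volume (parabolicRegion u s) = volume (parabolicRegion e s) := by
    rw [← lintegral_indicator_one (measurableSet_parabolicRegion u s),
      ← lintegral_indicator_one (measurableSet_parabolicRegion e s)]
    exact lintegral_norm_inner_eq hu he
      fun a b => ({p : ℝ × ℝ | s < p.2 ∧ p.2 < 2 * s ∧ p.1 ^ 2 - p.2 ^ 2 ≤ s}.indicator 1 (a, b))
  -- Half-width of an inscribed box: `n` transverse coordinates of square at most `s / (n + 1)` sum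
  -- to at most `s`. Dividing by `n + 1` also covers `n = 0`.
  set q : ℝ := √s / √((n : ℝ) + 1) with hq_def
  have hq : 0 ≤ q := by positivity
  have hq2 : q ^ 2 = s / ((n : ℝ) + 1) := by
    rw [hq_def, div_pow, Real.sq_sqrt hs.le, Real.sq_sqrt (by positivity)]
  let B : Fin (n + 1) → Set ℝ := Fin.cons (Set.Ioo s (2 * s)) fun _ => Set.Icc (-q) q
  have hB : volume (Set.univ.pi B) =
      ENNReal.ofReal ((2 / √((n : ℝ) + 1)) ^ n * s ^ (((n : ℝ) + 2) / 2)) := by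
    rw [volume_pi_pi, Fin.prod_univ_succ]
    simp only [B, Fin.cons_zero, Fin.cons_succ, Real.volume_Ioo, Real.volume_Icc,
      Finset.prod_const, Finset.card_univ, Fintype.card_fin]
    rw [← ENNReal.ofReal_pow (by linarith), ← ENNReal.ofReal_mul (by linarith)]
    congr 1
    have : s ^ (((n : ℝ) + 2) / 2) = s * √s ^ n := by
      rw [show ((n : ℝ) + 2) / 2 = 1 + 1 / 2 * n by ring, Real.rpow_add hs, Real.rpow_one,
        Real.rpow_mul hs.le, ← Real.sqrt_eq_rpow, Real.rpow_natCast]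
    rw [this, hq_def, show 2 * s - s = s by ring,
      show √s / √((n : ℝ) + 1) - -(√s / √((n : ℝ) + 1)) = 2 / √((n : ℝ) + 1) * √s by ring,
      mul_pow]
    ring
  rw [hvol, ← hB, ← (PiLp.volume_preserving_ofLp (Fin (n + 1))).measure_preimage
    (MeasurableSet.univ_pi fun i => by
      refine Fin.cases ?_ (fun j => ?_) i
      · exact measurableSet_Ioo
      · exact measurableSet_Icc).nullMeasurableSet]
  refine measure_mono fun y hy => ?_
  simp only [Set.mem_preimage, Set.mem_pi, Set.mem_univ, true_implies] at hy
  have h0 := hy 0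
  simp only [B, Fin.cons_zero, Set.mem_Ioo] at h0
  have h1 : ∀ j : Fin n, (y j.succ) ^ 2 ≤ s / ((n : ℝ) + 1) := fun j => by
    have := hy j.succ
    simp only [B, Fin.cons_succ, Set.mem_Icc] at this
    rw [← hq2]
    exact sq_le_sq' this.1 this.2
  have hin : inner ℝ e y = y 0 := by
    rw [he_def, EuclideanSpace.inner_single_left]; simp
  refine ⟨hin ▸ h0.1, hin ▸ h0.2, ?_⟩
  rw [hin, EuclideanSpace.real_norm_sq_eq, Fin.sum_univ_succ]
  have h2 : ∑ j : Fin n, (y j.succ) ^ 2 ≤ n * (s / ((n : ℝ) + 1)) := by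
    simpa using Finset.sum_le_sum fun j (_ : j ∈ Finset.univ) => h1 j
  have h3 : n * (s / ((n : ℝ) + 1)) ≤ s := by
    rw [mul_div_assoc', div_le_iff₀ (by positivity)]; nlinarith
  linarith

/-- In the ball of radius `2s` the squared transverse part is `(|y| - u·y)(|y| + u·y) ≤ 4s (|y| -
u·y)`. The weight is thus at most a Gaussian of width `√s` in `n` coordinates, over an axial
interval of length `4s`. -/
theorem exists_setLIntegral_exp_le (n : ℕ) {m : ℝ} (hm : 0 < m) : ∃ C : ℝ, 0 < C ∧
    ∀ (u : EuclideanSpace ℝ (Fin (n + 1))), ‖u‖ = 1 → ∀ s : ℝ, 0 < s →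
      ∫⁻ y in Metric.closedBall (0 : EuclideanSpace ℝ (Fin (n + 1))) (2 * s),
        ENNReal.ofReal (Real.exp (-m * (‖y‖ - inner ℝ u y))) ≤
      ENNReal.ofReal (C * s ^ (((n : ℝ) + 2) / 2)) := by
  set e : EuclideanSpace ℝ (Fin (n + 1)) := EuclideanSpace.single 0 1 with he_def
  have he : ‖e‖ = 1 := by simp [he_def]
  refine ⟨4 * √(Real.pi * 4 / m) ^ n, by positivity, fun u hu s hs => ?_⟩
  have hrot := lintegral_norm_inner_eq hu he
      fun a b => (Set.Iic (2 * s)).indicator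
        (fun a => ENNReal.ofReal (Real.exp (-m * (a - b)))) a
  let F : Fin (n + 1) → ℝ → ℝ := Fin.cons ((Set.Icc (-(2 * s)) (2 * s)).indicator 1)
    fun _ t => Real.exp (-(m / (4 * s)) * t ^ 2)
  have hF0 : ∀ i t, 0 ≤ F i t := fun i t => by
    refine Fin.cases ?_ (fun j => ?_) i
    · simp only [F, Fin.cons_zero]; exact Set.indicator_nonneg (fun _ _ => zero_le_one) _
    · simp only [F, Fin.cons_succ]; positivity
  have hFint : ∀ i, Integrable (F i) := fun i => by
    refine Fin.cases ?_ (fun j => ?_) i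
    · simp only [F, Fin.cons_zero]
      exact (integrable_indicator_iff measurableSet_Icc).2 (by simp [Pi.one_def])
    · simp only [F, Fin.cons_succ]
      exact integrable_exp_neg_mul_sq (by positivity)
  have hpi : ∫⁻ z : Fin (n + 1) → ℝ, ENNReal.ofReal (∏ i, F i (z i)) =
      ENNReal.ofReal (4 * √(Real.pi * 4 / m) ^ n * s ^ (((n : ℝ) + 2) / 2)) := by
    have hint : Integrable fun z : Fin (n + 1) → ℝ => ∏ i, F i (z i) :=
      Integrable.fintype_prod hFint
    rw [← ofReal_integral_eq_lintegral_ofReal hint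
      (Eventually.of_forall fun z => Finset.prod_nonneg fun i _ => hF0 i _)]
    congr 1
    rw [integral_fintype_prod_volume_eq_prod, Fin.prod_univ_succ]
    simp only [F, Fin.cons_zero, Fin.cons_succ, Finset.prod_const, Finset.card_univ,
      Fintype.card_fin]
    rw [integral_indicator_one measurableSet_Icc, integral_gaussian, Real.volume_real_Icc_of_le (by linarith)]
    have : s ^ (((n : ℝ) + 2) / 2) = s * √s ^ n := by
      rw [show ((n : ℝ) + 2) / 2 = 1 + 1 / 2 * n by ring, Real.rpow_add hs, Real.rpow_one,
        Real.rpow_mul hs.le, ← Real.sqrt_eq_rpow, Real.rpow_natCast]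
    rw [this, show Real.pi / (m / (4 * s)) = Real.pi * 4 / m * s by field_simp,
      Real.sqrt_mul (by positivity), mul_pow]
    ring
  calc ∫⁻ y in Metric.closedBall (0 : EuclideanSpace ℝ (Fin (n + 1))) (2 * s),
        ENNReal.ofReal (Real.exp (-m * (‖y‖ - inner ℝ u y)))
      = ∫⁻ y : EuclideanSpace ℝ (Fin (n + 1)), (Set.Iic (2 * s)).indicator
        (fun a => ENNReal.ofReal (Real.exp (-m * (a - inner ℝ u y)))) ‖y‖ := by
        rw [← lintegral_indicator Metric.isClosed_closedBall.measurableSet]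
        refine lintegral_congr fun y => ?_
        by_cases hy : ‖y‖ ≤ 2 * s
        · rw [Set.indicator_of_mem (by simpa using hy), Set.indicator_of_mem (by exact hy)]
        · rw [Set.indicator_of_notMem (by simpa using hy), Set.indicator_of_notMem (by exact hy)]
    _ = ∫⁻ z : Fin (n + 1) → ℝ, _ := by rw [hrot, lintegral_euclidean_eq_pi]
    _ ≤ ∫⁻ z : Fin (n + 1) → ℝ, ENNReal.ofReal (∏ i, F i (z i)) := by
        refine lintegral_mono fun z => ?_
        simp only
        set y : EuclideanSpace ℝ (Fin (n + 1)) := WithLp.toLp 2 z with hy_def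
        have hin : inner ℝ e y = z 0 := by
          rw [he_def, EuclideanSpace.inner_single_left]; simp [hy_def]
        rw [hin, Set.indicator_apply]
        split_ifs with hy
        swap
        · exact zero_le
        refine ENNReal.ofReal_le_ofReal ?_
        have hns : ‖y‖ ^ 2 = z 0 ^ 2 + ∑ j : Fin n, z j.succ ^ 2 := by
          rw [EuclideanSpace.real_norm_sq_eq, Fin.sum_univ_succ]
        have hsum : 0 ≤ ∑ j : Fin n, z j.succ ^ 2 := Finset.sum_nonneg fun _ _ => sq_nonneg _
        have habs : |z 0| ≤ ‖y‖ := abs_le_of_sq_le_sq (by linarith) (norm_nonneg _)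
        have hy' : ‖y‖ ≤ 2 * s := hy
        have hz := abs_le.1 (habs.trans hy')
        have h0 : (Set.Icc (-(2 * s)) (2 * s)).indicator (1 : ℝ → ℝ) (z 0) = 1 :=
          Set.indicator_of_mem (Set.mem_Icc.2 hz) _
        rw [Fin.prod_univ_succ]
        simp only [F, Fin.cons_zero, Fin.cons_succ]
        rw [h0, one_mul, ← Real.exp_sum]
        refine Real.exp_le_exp.2 ?_
        rw [← Finset.mul_sum]
        have hz0 := le_abs_self (z 0)
        have key : (∑ j : Fin n, z j.succ ^ 2) ≤ (‖y‖ - z 0) * (4 * s) := by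
          have : ∑ j : Fin n, z j.succ ^ 2 = (‖y‖ - z 0) * (‖y‖ + z 0) := by linarith
          rw [this]
          exact mul_le_mul_of_nonneg_left (by linarith) (by linarith)
        have : (∑ j : Fin n, z j.succ ^ 2) / (4 * s) ≤ ‖y‖ - z 0 :=
          (div_le_iff₀ (by positivity)).2 key
        have := mul_le_mul_of_nonneg_left this hm.le
        have h5 : m / (4 * s) * (∑ j : Fin n, z j.succ ^ 2) =
          m * ((∑ j : Fin n, z j.succ ^ 2) / (4 * s)) := by ring
        linarith
    _ = _ := hpi

/-! ### Pointwise bounds for the profile and the convolution quotient. -/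

theorem expProfile_pos (m β s : ℝ) : 0 < expProfile m β s :=
  mul_pos (Real.exp_pos _) (Real.rpow_pos_of_pos (lt_max_of_lt_left one_pos) _)

theorem inner_le_norm_of_norm_eq_one {n : ℕ} {u : EuclideanSpace ℝ (Fin n)} (hu : ‖u‖ = 1)
    (y : EuclideanSpace ℝ (Fin n)) : inner ℝ u y ≤ ‖y‖ := by
  simpa [hu] using real_inner_le_norm u y

/-- With `a = u·y > s`, one has `|y|² ≤ a² + s < (a + 1/2)²`. -/
theorem norm_le_of_mem_parabolicRegion {n : ℕ} {u y : EuclideanSpace ℝ (Fin n)} {s : ℝ}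
    (hy : y ∈ parabolicRegion u s) : ‖y‖ ≤ inner ℝ u y + 1 / 2 := by
  obtain ⟨h1, h2, h3⟩ := hy
  exact abs_le_of_sq_le_sq (by nlinarith) (by linarith) |> (abs_le.1 · |>.2)

/-- Here `R - u·y > 2s` absorbs the transverse square. Together with the previous bound, `|Ru - y| +
|y| ≤ R + 1`. -/
theorem norm_smul_sub_le_of_mem_parabolicRegion {n : ℕ} {u y : EuclideanSpace ℝ (Fin n)}
    {s R : ℝ} (hu : ‖u‖ = 1) (hR : 4 * s ≤ R) (hy : y ∈ parabolicRegion u s) :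
    ‖R • u - y‖ ≤ R - inner ℝ u y + 1 / 2 := by
  obtain ⟨h1, h2, h3⟩ := hy
  refine (abs_le.1 (abs_le_of_sq_le_sq ?_ (by linarith))).2
  rw [norm_sub_sq_real, norm_smul, hu, real_inner_smul_left, mul_one, Real.norm_eq_abs, sq_abs]
  nlinarith

section Bounds

variable {n : ℕ} {m β c₁ c₂ : ℝ} {f : EuclideanSpace ℝ (Fin n) → ℝ}

theorem le_expProfile_of_le {a s : ℝ} (hβ : 0 ≤ β) (ha : max 1 a ≤ s) :
    Real.exp (-m * a) * s ^ (-β) ≤ expProfile m β a :=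
  mul_le_mul_of_nonneg_left
    (Real.rpow_le_rpow_of_nonpos (lt_max_of_lt_left one_pos) ha (by linarith)) (Real.exp_pos _).le

theorem expProfile_le_of_le {a s : ℝ} (hβ : 0 ≤ β) (hs : 0 < s) (ha : s ≤ max 1 a) :
    expProfile m β a ≤ Real.exp (-m * a) * s ^ (-β) :=
  mul_le_mul_of_nonneg_left (Real.rpow_le_rpow_of_nonpos hs ha (by linarith)) (Real.exp_pos _).le

theorem le_exp_mul_of_mem_parabolicRegion (hm : 0 < m) (hβ : 0 ≤ β) (hc₁ : 0 < c₁)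
    (hlow : ∀ x, x ≠ 0 → c₁ * expProfile m β ‖x‖ ≤ f x)
    {u y : EuclideanSpace ℝ (Fin n)} {s : ℝ} (hu : ‖u‖ = 1) (hs : 1 ≤ s)
    (hy : y ∈ parabolicRegion u s) :
    c₁ * Real.exp (-m) * (3 * s) ^ (-β) ≤ Real.exp (m * inner ℝ u y) * f y := by
  have hny := norm_le_of_mem_parabolicRegion hy
  have hin := inner_le_norm_of_norm_eq_one hu y
  have hy0 : y ≠ 0 := norm_pos_iff.1 (by linarith [hy.1])
  have h1 := le_expProfile_of_le (m := m) hβ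
    (show max 1 ‖y‖ ≤ 3 * s from max_le (by linarith) (by linarith [hy.2.1]))
  calc c₁ * Real.exp (-m) * (3 * s) ^ (-β)
      ≤ c₁ * Real.exp (m * inner ℝ u y + -m * ‖y‖) * (3 * s) ^ (-β) := by
        gcongr; nlinarith
    _ = Real.exp (m * inner ℝ u y) * (c₁ * (Real.exp (-m * ‖y‖) * (3 * s) ^ (-β))) := by
        rw [Real.exp_add]; ring
    _ ≤ _ := by
        gcongr
        exact (mul_le_mul_of_nonneg_left h1 hc₁.le).trans (hlow y hy0)

/-- The detour through `y` is longer than `R` by at most 1, which costs `exp (-m)`. Since `|Ru - y|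
≤ R`, the power factor of `f (R • u - y)` dominates the `R ^ (-β)` of `f (R • u)`; only that of `f
y` remains. -/
theorem le_div_of_mem_parabolicRegion (hm : 0 < m) (hβ : 0 ≤ β) (hc₁ : 0 < c₁) (hc₂ : 0 < c₂)
    (hlow : ∀ x, x ≠ 0 → c₁ * expProfile m β ‖x‖ ≤ f x)
    (hup : ∀ x, x ≠ 0 → f x ≤ c₂ * expProfile m β ‖x‖)
    {u y : EuclideanSpace ℝ (Fin n)} {s R : ℝ} (hu : ‖u‖ = 1) (hs : 1 ≤ s) (hR : 4 * s ≤ R)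
    (hy : y ∈ parabolicRegion u s) :
    c₁ ^ 2 / c₂ * Real.exp (-m) * (3 * s) ^ (-β) ≤ f (R • u - y) * f y / f (R • u) := by
  have hny := norm_le_of_mem_parabolicRegion hy
  have hnz := norm_smul_sub_le_of_mem_parabolicRegion hu hR hy
  have hin := inner_le_norm_of_norm_eq_one hu y
  have hin' := inner_le_norm_of_norm_eq_one hu (R • u - y)
  rw [inner_sub_right, real_inner_smul_right, real_inner_self_eq_norm_sq, hu] at hin'
  have hy0 : y ≠ 0 := norm_pos_iff.1 (by linarith [hy.1])
  have hz0 : R • u - y ≠ 0 := norm_pos_iff.1 (by linarith [hy.2.1])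
  have hx : ‖R • u‖ = R := by
    rw [norm_smul, hu, mul_one, Real.norm_eq_abs, abs_of_nonneg (by linarith)]
  have hx0 : R • u ≠ 0 := norm_pos_iff.1 (by linarith)
  have hR0 : 0 < R := by linarith
  have hfx : 0 < f (R • u) := (mul_pos hc₁ (expProfile_pos _ _ _)).trans_le (hlow _ hx0)
  have hy1 := (mul_le_mul_of_nonneg_left (le_expProfile_of_le (m := m) hβ
    (show max 1 ‖y‖ ≤ 3 * s from max_le (by linarith) (by linarith [hy.2.1]))) hc₁.le).trans
    (hlow y hy0)
  have hz1 := (mul_le_mul_of_nonneg_left (le_expProfile_of_le (m := m) hβ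
    (show max 1 ‖R • u - y‖ ≤ R from max_le (by linarith) (by linarith [hy.1]))) hc₁.le).trans
    (hlow _ hz0)
  have hx1 := (hup _ hx0).trans (mul_le_mul_of_nonneg_left (expProfile_le_of_le (m := m) hβ hR0
    (show R ≤ max 1 ‖R • u‖ from hx.symm ▸ le_max_right _ _)) hc₂.le)
  rw [hx] at hx1
  rw [le_div_iff₀ hfx]
  calc c₁ ^ 2 / c₂ * Real.exp (-m) * (3 * s) ^ (-β) * f (R • u)
      ≤ c₁ ^ 2 / c₂ * Real.exp (-m) * (3 * s) ^ (-β) * (c₂ * (Real.exp (-m * R) * R ^ (-β))) := by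
        gcongr
    _ = c₁ ^ 2 * Real.exp (-m + -m * R) * (3 * s) ^ (-β) * R ^ (-β) := by
        rw [Real.exp_add]; field_simp
    _ ≤ c₁ ^ 2 * Real.exp (-m * ‖R • u - y‖ + -m * ‖y‖) * (3 * s) ^ (-β) * R ^ (-β) := by
        gcongr c₁ ^ 2 * Real.exp ?_ * _ * _
        nlinarith
    _ = c₁ * (Real.exp (-m * ‖R • u - y‖) * R ^ (-β)) *
          (c₁ * (Real.exp (-m * ‖y‖) * (3 * s) ^ (-β))) := by
        rw [Real.exp_add]; ring
    _ ≤ _ := mul_le_mul hz1 hy1 (by positivity) (le_trans (by positivity) hz1)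

/-- The farther point satisfies `|x - y| ≥ |x|/2`, whence `2 ^ β`, and `|x - y| ≥ |x| - u·y` gives
the exponential. -/
theorem div_le_of_norm_le (hm : 0 < m) (hβ : 0 ≤ β) (hc₁ : 0 < c₁) (hc₂ : 0 < c₂)
    (hnonneg : ∀ x, 0 ≤ f x)
    (hlow : ∀ x, x ≠ 0 → c₁ * expProfile m β ‖x‖ ≤ f x)
    (hup : ∀ x, x ≠ 0 → f x ≤ c₂ * expProfile m β ‖x‖)
    {x y : EuclideanSpace ℝ (Fin n)} (hx : x ≠ 0) (hy : ‖y‖ ≤ ‖x - y‖) :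
    f (x - y) * f y / f x ≤
      c₂ / c₁ * 2 ^ β * (Real.exp (m * inner ℝ (‖x‖⁻¹ • x) y) * f y) := by
  have hx0 : 0 < ‖x‖ := norm_pos_iff.2 hx
  have hu : ‖‖x‖⁻¹ • x‖ = 1 := by rw [norm_smul, norm_inv, norm_norm, inv_mul_cancel₀ hx0.ne']
  have hfx : 0 < f x := (mul_pos hc₁ (expProfile_pos _ _ _)).trans_le (hlow _ hx)
  have htri : ‖x‖ ≤ ‖x - y‖ + ‖y‖ := by simpa using norm_add_le (x - y) y
  have hz0 : x - y ≠ 0 := norm_pos_iff.1 (by linarith)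
  have hin := inner_le_norm_of_norm_eq_one hu (x - y)
  rw [inner_sub_right, real_inner_smul_left, real_inner_self_eq_norm_sq, sq, ← mul_assoc,
    inv_mul_cancel₀ hx0.ne', one_mul] at hin
  have hM : 0 < max 1 ‖x‖ := lt_max_of_lt_left one_pos
  have hz1 := (hup _ hz0).trans (mul_le_mul_of_nonneg_left (expProfile_le_of_le (m := m) hβ
    (half_pos hM) (show max 1 ‖x‖ / 2 ≤ max 1 ‖x - y‖ by
      rcases max_cases 1 ‖x‖ with h | h <;> rcases max_cases 1 ‖x - y‖ with h' | h' <;>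
        linarith)) hc₂.le)
  have h2 : (max 1 ‖x‖ / 2) ^ (-β) = 2 ^ β * (max 1 ‖x‖) ^ (-β) := by
    rw [Real.div_rpow hM.le zero_le_two, Real.rpow_neg zero_le_two, div_inv_eq_mul, mul_comm]
  rw [h2] at hz1
  have hz2 : f (x - y) ≤
      c₂ / c₁ * 2 ^ β * Real.exp (m * inner ℝ (‖x‖⁻¹ • x) y) * f x := by
    calc f (x - y) ≤ c₂ * (Real.exp (-m * ‖x - y‖) * (2 ^ β * (max 1 ‖x‖) ^ (-β))) := hz1
      _ ≤ c₂ * (Real.exp (m * inner ℝ (‖x‖⁻¹ • x) y + -m * ‖x‖) *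
            (2 ^ β * (max 1 ‖x‖) ^ (-β))) := by
          gcongr; nlinarith
      _ = c₂ / c₁ * 2 ^ β * Real.exp (m * inner ℝ (‖x‖⁻¹ • x) y) *
            (c₁ * expProfile m β ‖x‖) := by
          rw [Real.exp_add, expProfile]; field_simp
      _ ≤ _ := by gcongr; exact hlow x hx
  rw [div_le_iff₀ hfx]
  calc f (x - y) * f y ≤ _ := mul_le_mul_of_nonneg_right hz2 (hnonneg y)
    _ = _ := by ring

end Bounds

/-! ### Dyadic summation and the tilted moment. -/

/-- A function bounded below by `κ s ^ (-β)` on a parabolic region has integral at least of order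
`s ^ ((d + 1) / 2 - β)`. -/
theorem exists_le_setLIntegral_parabolicRegion (n : ℕ) (β : ℝ) {κ : ℝ} (hκ : 0 < κ) :
    ∃ c : ℝ, 0 < c ∧ ∀ (u : EuclideanSpace ℝ (Fin (n + 1))), ‖u‖ = 1 → ∀ s : ℝ, 0 < s →
      ∀ G : EuclideanSpace ℝ (Fin (n + 1)) → ℝ≥0∞,
      (∀ y ∈ parabolicRegion u s, ENNReal.ofReal (κ * (3 * s) ^ (-β)) ≤ G y) →
      ENNReal.ofReal (c * s ^ (((n : ℝ) + 2) / 2 - β)) ≤ ∫⁻ y in parabolicRegion u s, G y := by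
  obtain ⟨c, hc, h⟩ := exists_le_volume_parabolicRegion n
  refine ⟨κ * 3 ^ (-β) * c, by positivity, fun u hu s hs G hG => ?_⟩
  calc ENNReal.ofReal (κ * 3 ^ (-β) * c * s ^ (((n : ℝ) + 2) / 2 - β))
      = ENNReal.ofReal (κ * (3 * s) ^ (-β)) * ENNReal.ofReal (c * s ^ (((n : ℝ) + 2) / 2)) := by
        rw [← ENNReal.ofReal_mul (by positivity), Real.mul_rpow zero_le_three hs.le,
          sub_eq_add_neg, Real.rpow_add hs]
        congr 1; ring
    _ ≤ ENNReal.ofReal (κ * (3 * s) ^ (-β)) * volume (parabolicRegion u s) := by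
        gcongr; exact h u hu s hs
    _ = ∫⁻ y in parabolicRegion u s, ENNReal.ofReal (κ * (3 * s) ^ (-β)) := by
        rw [setLIntegral_const]
    _ ≤ _ := setLIntegral_mono' (measurableSet_parabolicRegion u s) hG

theorem pairwise_disjoint_parabolicRegion {n : ℕ} (u : EuclideanSpace ℝ (Fin n)) {r : ℝ}
    (hr : 0 < r) : Pairwise (Function.onFun Disjoint fun k : ℕ => parabolicRegion u (2 ^ k * r)) := by
  refine (pairwise_disjoint_on _).2 fun i j hij => Set.disjoint_left.2 fun y hi hj => ?_
  have h1 : (2 : ℝ) ^ (i + 1) ≤ 2 ^ j := pow_le_pow_right₀ one_le_two hij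
  have h2 := hi.2.1.trans_le (by rw [← mul_assoc, ← pow_succ']; gcongr : _ ≤ 2 ^ j * r)
  exact (h2.trans hj.1).false

/-- Source of all divergence: for `β` at most critical, every dyadic scale contributes at least a
fixed amount. -/
theorem nat_mul_le_setLIntegral_of_parabolicRegion {n : ℕ} {u : EuclideanSpace ℝ (Fin n)} {r : ℝ}
    (hr : 0 < r) (G : EuclideanSpace ℝ (Fin n) → ℝ≥0∞) {a : ℝ≥0∞} (N : ℕ)
    (S : Set (EuclideanSpace ℝ (Fin n)))
    (hS : ∀ k < N, parabolicRegion u (2 ^ k * r) ⊆ S)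
    (hG : ∀ k < N, a ≤ ∫⁻ y in parabolicRegion u (2 ^ k * r), G y) :
    N * a ≤ ∫⁻ y in S, G y := by
  calc N * a = ∑ k ∈ Finset.range N, a := by simp
    _ ≤ ∑ k ∈ Finset.range N, ∫⁻ y in parabolicRegion u (2 ^ k * r), G y :=
        Finset.sum_le_sum fun k hk => hG k (Finset.mem_range.1 hk)
    _ = ∫⁻ y in ⋃ k ∈ Finset.range N, parabolicRegion u (2 ^ k * r), G y :=
        (lintegral_biUnion_finset (fun i _ j _ hij => pairwise_disjoint_parabolicRegion u hr hij)
          (fun k _ => measurableSet_parabolicRegion u _) G).symm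
    _ ≤ _ := lintegral_mono_set (Set.iUnion₂_subset fun k hk => hS k (Finset.mem_range.1 hk))

/-- Dyadic shells have contributions bounded by a geometric series of ratio `2 ^ (p - β) < 1`. -/
theorem exists_setLIntegral_norm_gt_le (n : ℕ) {m β c₂ : ℝ} (hm : 0 < m) (hβ : 0 ≤ β)
    (hc₂ : 0 < c₂) (hβ' : ((n : ℝ) + 2) / 2 < β) :
    ∃ C : ℝ, 0 < C ∧ ∀ (f : EuclideanSpace ℝ (Fin (n + 1)) → ℝ),
      (∀ x, x ≠ 0 → f x ≤ c₂ * expProfile m β ‖x‖) →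
      ∀ u : EuclideanSpace ℝ (Fin (n + 1)), ‖u‖ = 1 → ∀ r : ℝ, 1 ≤ r →
      ∫⁻ y in {y | r < ‖y‖}, ENNReal.ofReal (Real.exp (m * inner ℝ u y) * f y) ≤
        ENNReal.ofReal (C * r ^ (((n : ℝ) + 2) / 2 - β)) := by
  obtain ⟨C, hC, h⟩ := exists_setLIntegral_exp_le n hm
  set p : ℝ := ((n : ℝ) + 2) / 2 with hp
  have hq0 : (0 : ℝ) < 2 ^ (p - β) := by positivity
  have hq1 : (2 : ℝ) ^ (p - β) < 1 := Real.rpow_lt_one_of_one_lt_of_neg one_lt_two (by linarith)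
  have hq2 : (0 : ℝ) < (1 - 2 ^ (p - β))⁻¹ := inv_pos.2 (by linarith)
  refine ⟨c₂ * C * (1 - 2 ^ (p - β))⁻¹, by positivity, fun f hup u hu r hr => ?_⟩
  have hr0 : 0 < r := by linarith
  set G : EuclideanSpace ℝ (Fin (n + 1)) → ℝ≥0∞ :=
    fun y => ENNReal.ofReal (Real.exp (m * inner ℝ u y) * f y) with hG
  set A : ℕ → Set (EuclideanSpace ℝ (Fin (n + 1))) :=
    fun k => {y | 2 ^ k * r < ‖y‖ ∧ ‖y‖ ≤ 2 * (2 ^ k * r)} with hA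
  have hAm : ∀ k, MeasurableSet (A k) := fun k => by
    simp only [hA]; measurability
  have hcover : {y : EuclideanSpace ℝ (Fin (n + 1)) | r < ‖y‖} ⊆ ⋃ k, A k := fun y hy => by
    have hy' : r < ‖y‖ := hy
    have hex : ∃ k : ℕ, ‖y‖ ≤ 2 * (2 ^ k * r) := by
      obtain ⟨k, hk⟩ := pow_unbounded_of_one_lt ‖y‖ one_lt_two
      exact ⟨k, by nlinarith [mul_le_mul_of_nonneg_left hr (show (0 : ℝ) ≤ 2 ^ k by positivity)]⟩
    -- Minimality of the index gives the lower bound on `‖y‖`; at index 0 it is `r < ‖y‖`.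
    refine Set.mem_iUnion.2 ⟨Nat.find hex, ?_, Nat.find_spec hex⟩
    rcases Nat.eq_zero_or_pos (Nat.find hex) with h0 | h0
    · rw [h0]; simpa using hy'
    · have := Nat.find_min hex (Nat.sub_lt h0 one_pos)
      rw [not_le, ← mul_assoc, ← pow_succ', Nat.sub_add_cancel (show 1 ≤ Nat.find hex from h0)] at this
      exact this
  have hshell : ∀ k, ∫⁻ y in A k, G y ≤
      ENNReal.ofReal (c₂ * C * r ^ (p - β) * (2 ^ (p - β)) ^ k) := fun k => by
    set s : ℝ := 2 ^ k * r with hs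
    have hs0 : 0 < s := by positivity
    calc ∫⁻ y in A k, G y
        ≤ ∫⁻ y in A k, ENNReal.ofReal (c₂ * s ^ (-β)) *
            ENNReal.ofReal (Real.exp (-m * (‖y‖ - inner ℝ u y))) := by
          refine setLIntegral_mono' (hAm k) fun y hy => ?_
          rw [← ENNReal.ofReal_mul (by positivity)]
          refine ENNReal.ofReal_le_ofReal ?_
          have hy0 : y ≠ 0 := norm_pos_iff.1 (hs0.trans hy.1)
          have h1 := (hup y hy0).trans (mul_le_mul_of_nonneg_left
            (expProfile_le_of_le (m := m) hβ hs0 (hy.1.le.trans (le_max_right 1 _))) hc₂.le)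
          calc Real.exp (m * inner ℝ u y) * f y
              ≤ Real.exp (m * inner ℝ u y) * (c₂ * (Real.exp (-m * ‖y‖) * s ^ (-β))) := by
                gcongr
            _ = c₂ * s ^ (-β) * Real.exp (-m * (‖y‖ - inner ℝ u y)) := by
                rw [show -m * (‖y‖ - inner ℝ u y) = m * inner ℝ u y + -m * ‖y‖ by ring,
                  Real.exp_add]
                ring
      _ = ENNReal.ofReal (c₂ * s ^ (-β)) *
            ∫⁻ y in A k, ENNReal.ofReal (Real.exp (-m * (‖y‖ - inner ℝ u y))) :=
          lintegral_const_mul' _ _ ENNReal.ofReal_ne_top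
      _ ≤ ENNReal.ofReal (c₂ * s ^ (-β)) * ENNReal.ofReal (C * s ^ p) := by
          gcongr
          refine le_trans (lintegral_mono_set fun y hy => ?_) (h u hu s hs0)
          simpa using hy.2
      _ = _ := by
          rw [← ENNReal.ofReal_mul (by positivity)]
          congr 1
          have : s ^ (-β) * s ^ p = r ^ (p - β) * (2 ^ (p - β)) ^ k := by
            rw [← Real.rpow_add hs0, show -β + p = p - β by ring, hs,
              Real.mul_rpow (by positivity) hr0.le, ← Real.rpow_natCast, ← Real.rpow_natCast,
              ← Real.rpow_mul zero_le_two, ← Real.rpow_mul zero_le_two, mul_comm (k : ℝ), mul_comm]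
          calc c₂ * s ^ (-β) * (C * s ^ p) = c₂ * C * (s ^ (-β) * s ^ p) := by ring
            _ = _ := by rw [this]; ring
  calc ∫⁻ y in {y | r < ‖y‖}, G y ≤ ∫⁻ y in ⋃ k, A k, G y := lintegral_mono_set hcover
    _ ≤ ∑' k, ∫⁻ y in A k, G y := lintegral_iUnion_le _ _
    _ ≤ ∑' k : ℕ, ENNReal.ofReal (c₂ * C * r ^ (p - β) * (2 ^ (p - β)) ^ k) :=
        ENNReal.tsum_le_tsum hshell
    _ = ENNReal.ofReal (c₂ * C * (1 - 2 ^ (p - β))⁻¹ * r ^ (p - β)) := by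
        rw [← ENNReal.ofReal_tsum_of_nonneg (fun k => by positivity)
          ((summable_geometric_of_lt_one hq0.le hq1).mul_left _), tsum_mul_left,
          tsum_geometric_of_lt_one hq0.le hq1]
        congr 1; ring

theorem dirExpMoment_lt_top {n : ℕ} {m β c₂ : ℝ} (hm : 0 < m) (hβ : 0 ≤ β)
    (hc₂ : 0 < c₂) (hβ' : ((n : ℝ) + 2) / 2 < β) {f : EuclideanSpace ℝ (Fin (n + 1)) → ℝ}
    (hup : ∀ x, x ≠ 0 → f x ≤ c₂ * expProfile m β ‖x‖)
    {u : EuclideanSpace ℝ (Fin (n + 1))} (hu : ‖u‖ = 1) : dirExpMoment f u m < ∞ := by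
  obtain ⟨C, hC, h⟩ := exists_setLIntegral_norm_gt_le n hm hβ hc₂ hβ'
  have h1 := (h f hup u hu 1 le_rfl).trans_lt ENNReal.ofReal_lt_top
  have hm1 : MeasurableSet {y : EuclideanSpace ℝ (Fin (n + 1)) | 1 < ‖y‖} := by measurability
  rw [dirExpMoment, ← lintegral_add_compl _ hm1]
  refine ENNReal.add_lt_top.2 ⟨h1, ?_⟩
  have hcompl : {y : EuclideanSpace ℝ (Fin (n + 1)) | 1 < ‖y‖}ᶜ = Metric.closedBall 0 1 := by
    ext y; simp
  rw [hcompl]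
  refine lt_of_le_of_lt (b := ∫⁻ y in Metric.closedBall (0 : EuclideanSpace ℝ (Fin (n + 1))) 1,
    ENNReal.ofReal c₂) ?_ ?_
  -- Nothing is known about `f 0`, so the bound holds off a null point.
  · refine setLIntegral_mono_ae' Metric.isClosed_closedBall.measurableSet ?_
    filter_upwards [compl_mem_ae_iff.2 (measure_singleton (0 : EuclideanSpace ℝ (Fin (n + 1))))]
      with y hy _
    refine ENNReal.ofReal_le_ofReal ?_
    have hin := inner_le_norm_of_norm_eq_one hu y
    have h2 := (hup y hy).trans (mul_le_mul_of_nonneg_left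
      (expProfile_le_of_le (m := m) hβ one_pos (le_max_left 1 ‖y‖)) hc₂.le)
    rw [Real.one_rpow, mul_one] at h2
    calc Real.exp (m * inner ℝ u y) * f y
        ≤ Real.exp (m * inner ℝ u y) * (c₂ * Real.exp (-m * ‖y‖)) := by gcongr
      _ = c₂ * Real.exp (m * inner ℝ u y + -m * ‖y‖) := by rw [Real.exp_add]; ring
      _ ≤ c₂ * Real.exp 0 := by gcongr; nlinarith
      _ = c₂ := by simp
  · rw [setLIntegral_const]
    exact ENNReal.mul_lt_top ENNReal.ofReal_lt_top measure_closedBall_lt_top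

/-! ### Upper bound for `convK`. -/

theorem setLIntegral_reflect {n : ℕ} (x : EuclideanSpace ℝ (Fin n))
    (G : EuclideanSpace ℝ (Fin n) → ℝ≥0∞) (hG : ∀ y, G (x - y) = G y)
    {S : Set (EuclideanSpace ℝ (Fin n))} (hS : MeasurableSet S) :
    ∫⁻ y in (fun y => x - y) ⁻¹' S, G y = ∫⁻ y in S, G y := by
  rw [← lintegral_indicator hS, ← lintegral_indicator (hS.preimage (by fun_prop)),
    ← lintegral_sub_left_eq_self (S.indicator G) x]
  refine lintegral_congr fun y => ?_
  by_cases hy : x - y ∈ S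
  · rw [Set.indicator_of_mem hy, Set.indicator_of_mem (by exact hy), hG]
  · rw [Set.indicator_of_notMem hy, Set.indicator_of_notMem (by exact hy)]

/-- Split by which of `y`, `x - y` is shorter; reflection identifies the halves, and each is
controlled by a tilted tail. -/
theorem convK_le {n : ℕ} {m β c₁ c₂ r : ℝ} {f : EuclideanSpace ℝ (Fin n) → ℝ}
    (hm : 0 < m) (hβ : 0 ≤ β) (hc₁ : 0 < c₁) (hc₂ : 0 < c₂)
    (hnonneg : ∀ x, 0 ≤ f x)
    (hlow : ∀ x, x ≠ 0 → c₁ * expProfile m β ‖x‖ ≤ f x)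
    (hup : ∀ x, x ≠ 0 → f x ≤ c₂ * expProfile m β ‖x‖) {a : ℝ≥0∞}
    (ha : ∀ u : EuclideanSpace ℝ (Fin n), ‖u‖ = 1 →
      ∫⁻ y in {y | r < ‖y‖}, ENNReal.ofReal (Real.exp (m * inner ℝ u y) * f y) ≤ a) :
    convK f r ≤ ENNReal.ofReal (2 * (c₂ / c₁ * 2 ^ β)) * a := by
  refine iSup₂_le fun x hx => ?_
  have hx0 : x ≠ 0 := norm_pos_iff.1 (by linarith)
  have hu : ‖‖x‖⁻¹ • x‖ = 1 := by
    rw [norm_smul, norm_inv, norm_norm, inv_mul_cancel₀ (norm_ne_zero_iff.2 hx0)]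
  have hfx : 0 < f x := (mul_pos hc₁ (expProfile_pos _ _ _)).trans_le (hlow _ hx0)
  set G : EuclideanSpace ℝ (Fin n) → ℝ≥0∞ :=
    fun y => ENNReal.ofReal (f (x - y) * f y) / ENNReal.ofReal (f x) with hG
  set S : Set (EuclideanSpace ℝ (Fin n)) := {y | r < ‖y‖ ∧ ‖y‖ ≤ ‖x - y‖} with hS
  have hSm : MeasurableSet S := by
    have h1 : MeasurableSet {y : EuclideanSpace ℝ (Fin n) | r < ‖y‖} :=
      measurableSet_lt (by fun_prop) (by fun_prop)
    have h2 : MeasurableSet {y : EuclideanSpace ℝ (Fin n) | ‖y‖ ≤ ‖x - y‖} :=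
      measurableSet_le (by fun_prop) (by fun_prop)
    exact h1.inter h2
  have hhalf : ∫⁻ y in S, G y ≤ ENNReal.ofReal (c₂ / c₁ * 2 ^ β) * a := by
    calc ∫⁻ y in S, G y
        ≤ ∫⁻ y in S, ENNReal.ofReal (c₂ / c₁ * 2 ^ β) *
            ENNReal.ofReal (Real.exp (m * inner ℝ (‖x‖⁻¹ • x) y) * f y) := by
          refine setLIntegral_mono' hSm fun y hy => ?_
          rw [← ENNReal.ofReal_mul (by positivity), hG]
          simp only
          rw [← ENNReal.ofReal_div_of_pos hfx]
          exact ENNReal.ofReal_le_ofReal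
            (div_le_of_norm_le hm hβ hc₁ hc₂ hnonneg hlow hup hx0 hy.2)
      _ = ENNReal.ofReal (c₂ / c₁ * 2 ^ β) *
            ∫⁻ y in S, ENNReal.ofReal (Real.exp (m * inner ℝ (‖x‖⁻¹ • x) y) * f y) :=
          lintegral_const_mul' _ _ ENNReal.ofReal_ne_top
      _ ≤ _ := by
          gcongr
          exact (lintegral_mono_set fun y hy => hy.1).trans (ha _ hu)
  calc ∫⁻ y in {y | r < ‖x - y‖ ∧ r < ‖y‖}, G y
      ≤ ∫⁻ y in S ∪ (fun y => x - y) ⁻¹' S, G y := by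
        refine lintegral_mono_set fun y hy => ?_
        rcases le_total ‖y‖ ‖x - y‖ with h | h
        · exact Or.inl ⟨hy.2, h⟩
        · exact Or.inr ⟨hy.1, by rwa [sub_sub_cancel]⟩
    _ ≤ (∫⁻ y in S, G y) + ∫⁻ y in (fun y => x - y) ⁻¹' S, G y := lintegral_union_le _ _ _
    _ = (∫⁻ y in S, G y) + ∫⁻ y in S, G y := by
        rw [setLIntegral_reflect x G (fun y => by simp only [hG, sub_sub_cancel, mul_comm]) hSm]
    _ ≤ ENNReal.ofReal (c₂ / c₁ * 2 ^ β) * a + ENNReal.ofReal (c₂ / c₁ * 2 ^ β) * a :=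
        add_le_add hhalf hhalf
    _ = _ := by
        rw [← two_mul, ENNReal.ofReal_mul zero_le_two, mul_assoc]; norm_num

/-! ### Divergence and two-sided bounds. -/

theorem ofReal_le_rpow_mul {c s q : ℝ} (hc : 0 < c) (hs : 1 ≤ s) (hq : 0 ≤ q) :
    ENNReal.ofReal c ≤ ENNReal.ofReal (c * s ^ q) :=
  ENNReal.ofReal_le_ofReal (le_mul_of_one_le_right hc.le (Real.one_le_rpow hs hq))

theorem ENNReal.eq_top_of_nat_mul_le {a b : ℝ≥0∞} (ha : a ≠ 0) (h : ∀ N : ℕ, N * a ≤ b) :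
    b = ∞ := by
  by_contra hb
  obtain ⟨N, hN⟩ := ENNReal.exists_nat_mul_gt ha hb
  exact (h N).not_gt hN

theorem dirExpMoment_eq_top {n : ℕ} {m β c₁ : ℝ} (hm : 0 < m) (hβ : 0 ≤ β)
    (hc₁ : 0 < c₁) (hβ' : β ≤ ((n : ℝ) + 2) / 2) {f : EuclideanSpace ℝ (Fin (n + 1)) → ℝ}
    (hlow : ∀ x, x ≠ 0 → c₁ * expProfile m β ‖x‖ ≤ f x)
    {u : EuclideanSpace ℝ (Fin (n + 1))} (hu : ‖u‖ = 1) : dirExpMoment f u m = ∞ := by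
  obtain ⟨c, hc, h⟩ := exists_le_setLIntegral_parabolicRegion n β
    (show 0 < c₁ * Real.exp (-m) by positivity)
  refine ENNReal.eq_top_of_nat_mul_le (a := ENNReal.ofReal c) (by simpa using hc) fun N => ?_
  rw [dirExpMoment, ← setLIntegral_univ]
  refine nat_mul_le_setLIntegral_of_parabolicRegion (u := u) one_pos _ N _
    (fun _ _ => Set.subset_univ _) fun k _ => ?_
  have hk : (1 : ℝ) ≤ 2 ^ k * 1 := by simpa using one_le_pow₀ one_le_two
  refine (ofReal_le_rpow_mul hc hk (by linarith : 0 ≤ ((n : ℝ) + 2) / 2 - β)).trans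
    (h u hu _ (by positivity) _ fun y hy => ENNReal.ofReal_le_ofReal ?_)
  exact le_exp_mul_of_mem_parabolicRegion hm hβ hc₁ hlow hu hk hy

/-- Lower bound for the integral defining `convK` over a parabolic region. -/
theorem exists_le_setLIntegral_div (n : ℕ) {m β c₁ c₂ : ℝ}
    (hm : 0 < m) (hβ : 0 ≤ β) (hc₁ : 0 < c₁) (hc₂ : 0 < c₂)
    {f : EuclideanSpace ℝ (Fin (n + 1)) → ℝ}
    (hlow : ∀ x, x ≠ 0 → c₁ * expProfile m β ‖x‖ ≤ f x)
    (hup : ∀ x, x ≠ 0 → f x ≤ c₂ * expProfile m β ‖x‖) :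
    ∃ c : ℝ, 0 < c ∧ ∀ (u : EuclideanSpace ℝ (Fin (n + 1))), ‖u‖ = 1 →
      ∀ s R : ℝ, 1 ≤ s → 4 * s ≤ R →
      ENNReal.ofReal (c * s ^ (((n : ℝ) + 2) / 2 - β)) ≤ ∫⁻ y in parabolicRegion u s,
        ENNReal.ofReal (f (R • u - y) * f y) / ENNReal.ofReal (f (R • u)) := by
  obtain ⟨c, hc, h⟩ := exists_le_setLIntegral_parabolicRegion n β
    (show 0 < c₁ ^ 2 / c₂ * Real.exp (-m) by positivity)
  refine ⟨c, hc, fun u hu s R hs hR => h u hu s (by linarith) _ fun y hy => ?_⟩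
  have hx0 : R • u ≠ 0 := norm_pos_iff.1 (by
    rw [norm_smul, hu, mul_one, Real.norm_eq_abs, abs_pos]; linarith)
  rw [← ENNReal.ofReal_div_of_pos ((mul_pos hc₁ (expProfile_pos _ _ _)).trans_le (hlow _ hx0))]
  exact ENNReal.ofReal_le_ofReal
    (le_div_of_mem_parabolicRegion hm hβ hc₁ hc₂ hlow hup hu hs hR hy)

theorem parabolicRegion_subset {n : ℕ} {u : EuclideanSpace ℝ (Fin n)} {s r R : ℝ} (hu : ‖u‖ = 1)
    (hr : 0 < r) (hs : r ≤ s) (hR : 4 * s ≤ R) :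
    parabolicRegion u s ⊆ {y | r < ‖R • u - y‖ ∧ r < ‖y‖} := fun y hy => by
  have hin := inner_le_norm_of_norm_eq_one hu y
  have hin' := inner_le_norm_of_norm_eq_one hu (R • u - y)
  rw [inner_sub_right, real_inner_smul_right, real_inner_self_eq_norm_sq, hu] at hin'
  exact ⟨by linarith [hy.2.1], by linarith [hy.1]⟩

theorem setLIntegral_le_convK {n : ℕ} {f : EuclideanSpace ℝ (Fin n) → ℝ}
    {u : EuclideanSpace ℝ (Fin n)} {r R : ℝ} (hu : ‖u‖ = 1) (hR : 1 ≤ R) :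
    ∫⁻ y in {y | r < ‖R • u - y‖ ∧ r < ‖y‖},
      ENNReal.ofReal (f (R • u - y) * f y) / ENNReal.ofReal (f (R • u)) ≤ convK f r :=
  le_iSup₂_of_le (R • u) (by rwa [norm_smul, hu, mul_one, Real.norm_eq_abs,
    abs_of_nonneg (by linarith)]) le_rfl

theorem convK_eq_top {n : ℕ} {m β c₁ c₂ : ℝ}
    (hm : 0 < m) (hβ : 0 ≤ β) (hc₁ : 0 < c₁) (hc₂ : 0 < c₂) (hβ' : β ≤ ((n : ℝ) + 2) / 2)
    {f : EuclideanSpace ℝ (Fin (n + 1)) → ℝ}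
    (hlow : ∀ x, x ≠ 0 → c₁ * expProfile m β ‖x‖ ≤ f x)
    (hup : ∀ x, x ≠ 0 → f x ≤ c₂ * expProfile m β ‖x‖) {r : ℝ} (hr : 1 < r) :
    convK f r = ∞ := by
  obtain ⟨c, hc, h⟩ := exists_le_setLIntegral_div n hm hβ hc₁ hc₂ hlow hup
  have hu : ‖(EuclideanSpace.single 0 1 : EuclideanSpace ℝ (Fin (n + 1)))‖ = 1 := by simp
  set u : EuclideanSpace ℝ (Fin (n + 1)) := EuclideanSpace.single 0 1
  refine ENNReal.eq_top_of_nat_mul_le (a := ENNReal.ofReal c) (by simpa using hc) fun N => ?_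
  have hN : (1 : ℝ) ≤ 2 ^ N := one_le_pow₀ one_le_two
  -- The point recedes with `N`, far enough to see `N` dyadic regions at once; only the supremum
  -- over points is shown infinite.
  refine le_trans ?_ (setLIntegral_le_convK (R := 4 * (2 ^ N * r)) hu (by nlinarith))
  have hk : ∀ k < N, (r ≤ 2 ^ k * r) ∧ 4 * (2 ^ k * r) ≤ 4 * (2 ^ N * r) := fun k hk => by
    have h1 : (1 : ℝ) ≤ 2 ^ k := one_le_pow₀ one_le_two
    have h2 : (2 : ℝ) ^ k ≤ 2 ^ N := pow_le_pow_right₀ one_le_two hk.le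
    exact ⟨by nlinarith, by gcongr⟩
  refine nat_mul_le_setLIntegral_of_parabolicRegion (u := u) (by linarith : 0 < r) _ N _
    (fun k hkN => parabolicRegion_subset hu (by linarith) (hk k hkN).1 (hk k hkN).2)
    fun k hkN => ?_
  have hk1 := hr.le.trans (hk k hkN).1
  exact (ofReal_le_rpow_mul hc hk1 (by linarith : 0 ≤ ((n : ℝ) + 2) / 2 - β)).trans
    (h u hu _ _ hk1 (hk k hkN).2)

theorem exists_convK_bounds {n : ℕ} {m β c₁ c₂ : ℝ}
    (hm : 0 < m) (hβ : 0 ≤ β) (hc₁ : 0 < c₁) (hc₂ : 0 < c₂) (hβ' : ((n : ℝ) + 2) / 2 < β)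
    {f : EuclideanSpace ℝ (Fin (n + 1)) → ℝ} (hnonneg : ∀ x, 0 ≤ f x)
    (hlow : ∀ x, x ≠ 0 → c₁ * expProfile m β ‖x‖ ≤ f x)
    (hup : ∀ x, x ≠ 0 → f x ≤ c₂ * expProfile m β ‖x‖) :
    ∃ c : ℝ, 1 ≤ c ∧ ∀ r : ℝ, 1 < r →
      ENNReal.ofReal (c⁻¹ * r ^ (((n : ℝ) + 2) / 2 - β)) ≤ convK f r ∧
      convK f r ≤ ENNReal.ofReal (c * r ^ (((n : ℝ) + 2) / 2 - β)) := by
  obtain ⟨a, ha, h⟩ := exists_le_setLIntegral_div n hm hβ hc₁ hc₂ hlow hup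
  obtain ⟨C, hC, h'⟩ := exists_setLIntegral_norm_gt_le n hm hβ hc₂ hβ'
  have hu : ‖(EuclideanSpace.single 0 1 : EuclideanSpace ℝ (Fin (n + 1)))‖ = 1 := by simp
  set u : EuclideanSpace ℝ (Fin (n + 1)) := EuclideanSpace.single 0 1
  set b : ℝ := 2 * (c₂ / c₁ * 2 ^ β) * C with hb
  have hc0 : (1 : ℝ) ≤ max 1 (max a⁻¹ b) := le_max_left _ _
  refine ⟨max 1 (max a⁻¹ b), hc0, fun r hr => ⟨?_, ?_⟩⟩
  · have hr0 : 0 < r := by linarith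
    -- One region at scale `r`, seen from `4 * r` along the axis, already has the right order.
    refine le_trans (ENNReal.ofReal_le_ofReal ?_) ((h u hu r (4 * r) hr.le le_rfl).trans
      ((lintegral_mono_set (parabolicRegion_subset hu hr0 le_rfl le_rfl)).trans
        (setLIntegral_le_convK hu (by linarith))))
    gcongr
    exact inv_le_of_inv_le₀ ha ((le_max_left _ _).trans (le_max_right _ _))
  · refine (convK_le hm hβ hc₁ hc₂ hnonneg hlow hup fun v hv => h' f hup v hv r hr.le).trans ?_
    have hr0 : 0 < r := by linarith
    rw [← ENNReal.ofReal_mul (by positivity), ← mul_assoc, ← hb]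
    refine ENNReal.ofReal_le_ofReal ?_
    gcongr
    exact (le_max_right _ _).trans (le_max_right _ _)

/-! ### Limits along a ray. -/

/-- Squeeze: `|tθ - y|² = (t - a)² + b` lies between `(t - a)²` and `(t - a + b/(2(t - a)))²`. -/
theorem tendsto_norm_smul_sub_sub {n : ℕ} {θ : EuclideanSpace ℝ (Fin n)} (hθ : ‖θ‖ = 1)
    (y : EuclideanSpace ℝ (Fin n)) :
    Tendsto (fun t : ℝ => ‖t • θ - y‖ - t) atTop (𝓝 (-inner ℝ θ y)) := by
  set a : ℝ := inner ℝ θ y with ha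
  set b : ℝ := ‖y‖ ^ 2 - a ^ 2 with hb
  have hlim : Tendsto (fun t : ℝ => -a + b / (2 * (t - a))) atTop (𝓝 (-a + 0)) := by
    refine tendsto_const_nhds.add (Tendsto.div_atTop tendsto_const_nhds ?_)
    exact (tendsto_atTop_add_const_right _ (-a) tendsto_id).const_mul_atTop two_pos
  rw [add_zero] at hlim
  have hb0 : 0 ≤ b := by
    have h : |a| ≤ ‖y‖ := by simpa [hθ] using abs_real_inner_le_norm θ y
    have := sq_le_sq' (by linarith [neg_abs_le a]) ((le_abs_self a).trans h)
    linarith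
  refine tendsto_of_tendsto_of_tendsto_of_le_of_le' tendsto_const_nhds hlim
    (Eventually.of_forall fun t => ?_) ?_
  · have h := inner_le_norm_of_norm_eq_one hθ (t • θ - y)
    rw [inner_sub_right, real_inner_smul_right, real_inner_self_eq_norm_sq, hθ] at h
    linarith
  · filter_upwards [eventually_gt_atTop a] with t ht
    have hta : 0 < t - a := by linarith
    have hq : 0 ≤ b / (2 * (t - a)) := by positivity
    have h : ‖t • θ - y‖ ≤ t - a + b / (2 * (t - a)) := by
      refine (abs_le.1 (abs_le_of_sq_le_sq ?_ (by linarith))).2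
      rw [norm_sub_sq_real, norm_smul, hθ, real_inner_smul_left, mul_one, Real.norm_eq_abs, sq_abs]
      have : (t - a) * (b / (2 * (t - a))) = b / 2 := by field_simp
      nlinarith [sq_nonneg (b / (2 * (t - a)))]
    linarith

theorem tendsto_expProfile_div {n : ℕ} (m β : ℝ) {θ : EuclideanSpace ℝ (Fin n)} (hθ : ‖θ‖ = 1)
    (y : EuclideanSpace ℝ (Fin n)) :
    Tendsto (fun t : ℝ => expProfile m β ‖t • θ - y‖ / expProfile m β t) atTop
      (𝓝 (Real.exp (m * inner ℝ θ y))) := by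
  have hD := tendsto_norm_smul_sub_sub hθ y
  have h1 : Tendsto (fun t : ℝ => Real.exp (-m * (‖t • θ - y‖ - t))) atTop
      (𝓝 (Real.exp (m * inner ℝ θ y))) := by
    have := (hD.const_mul (-m)).rexp
    rwa [neg_mul_neg] at this
  have h2 : Tendsto (fun t : ℝ => (1 + (‖t • θ - y‖ - t) / t) ^ (-β)) atTop (𝓝 1) := by
    have := (tendsto_const_nhds (x := (1 : ℝ))).add (hD.div_atTop tendsto_id)
    rw [add_zero] at this
    simpa using this.rpow_const (p := -β) (Or.inl one_ne_zero)
  have h3 := h1.mul h2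
  rw [mul_one] at h3
  refine h3.congr' ?_
  -- These thresholds force `1 ≤ ‖t • θ - y‖`, so both maxima in the profile disappear.
  filter_upwards [hD.eventually (eventually_gt_nhds (show -inner ℝ θ y - 1 < -inner ℝ θ y by
    linarith)), eventually_ge_atTop 1, eventually_ge_atTop (2 + inner ℝ θ y)] with t h4 h5 h6
  have ht : 0 < t := by linarith
  have hn : 1 ≤ ‖t • θ - y‖ := by linarith
  simp only [expProfile]
  rw [max_eq_right hn, max_eq_right h5, mul_div_mul_comm, ← Real.exp_sub,
    ← Real.div_rpow (by linarith) ht.le]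
  congr 2
  · ring
  · field_simp; ring

/-- Dominated convergence, with the majorant of `div_le_of_norm_le`. The sets `U t` stay general to
serve both the closed and the open half-space. -/
theorem tendsto_setLIntegral_conv {n : ℕ} {m β c₁ c₂ : ℝ} (hm : 0 < m) (hβ : 0 ≤ β) (hc₁ : 0 < c₁)
    (hc₂ : 0 < c₂) {f : EuclideanSpace ℝ (Fin n) → ℝ}
    (hf : AEMeasurable f) (hnonneg : ∀ x, 0 ≤ f x)
    (hlow : ∀ x, x ≠ 0 → c₁ * expProfile m β ‖x‖ ≤ f x)
    (hup : ∀ x, x ≠ 0 → f x ≤ c₂ * expProfile m β ‖x‖)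
    {θ : EuclideanSpace ℝ (Fin n)} (hθ : ‖θ‖ = 1) (hfin : dirExpMoment f θ m < ∞)
    (hshift : ∀ y, Tendsto (fun t : ℝ => f (t • θ - y) / f (t • θ)) atTop
      (𝓝 (Real.exp (m * inner ℝ θ y))))
    {U : ℝ → Set (EuclideanSpace ℝ (Fin n))} (hUm : ∀ t, MeasurableSet (U t))
    (hU : ∀ t, ∀ y ∈ U t, ‖y‖ ≤ ‖t • θ - y‖) (hU' : ∀ y, ∀ᶠ t in atTop, y ∈ U t) :
    Tendsto (fun t : ℝ => ∫⁻ y in U t,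
      ENNReal.ofReal (f (t • θ - y) * f y) / ENNReal.ofReal (f (t • θ))) atTop
      (𝓝 (dirExpMoment f θ m)) := by
  have hx0 : ∀ t : ℝ, 0 < t → t • θ ≠ 0 := fun t ht =>
    smul_ne_zero ht.ne' (norm_ne_zero_iff.1 (by rw [hθ]; exact one_ne_zero))
  have hfx : ∀ t : ℝ, 0 < t → 0 < f (t • θ) := fun t ht =>
    (mul_pos hc₁ (expProfile_pos _ _ _)).trans_le (hlow _ (hx0 t ht))
  refine Tendsto.congr (fun t => lintegral_indicator (hUm t) _) ?_
  refine tendsto_lintegral_filter_of_dominated_convergence'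
    (fun y => ENNReal.ofReal (c₂ / c₁ * 2 ^ β) *
      ENNReal.ofReal (Real.exp (m * inner ℝ θ y) * f y))
    (Eventually.of_forall fun t => ?_) ?_ ?_ ?_
  · refine AEMeasurable.indicator ?_ (hUm t)
    have h1 : AEMeasurable fun y => f (t • θ - y) :=
      hf.comp_quasiMeasurePreserving (quasiMeasurePreserving_sub_left volume (t • θ))
    exact ((h1.mul hf).ennreal_ofReal).div_const _
  · filter_upwards [eventually_gt_atTop 0] with t ht
    refine Eventually.of_forall fun y => ?_
    refine Set.indicator_apply_le' (fun hy => ?_) fun _ => zero_le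
    have hxn : ‖t • θ‖⁻¹ • t • θ = θ := by
      rw [norm_smul, hθ, mul_one, Real.norm_of_nonneg ht.le, smul_smul, inv_mul_cancel₀ ht.ne',
        one_smul]
    have := div_le_of_norm_le hm hβ hc₁ hc₂ hnonneg hlow hup (hx0 t ht) (hU t y hy)
    rw [hxn] at this
    rw [← ENNReal.ofReal_mul (by positivity), ← ENNReal.ofReal_div_of_pos (hfx t ht)]
    exact ENNReal.ofReal_le_ofReal this
  · rw [lintegral_const_mul' _ _ ENNReal.ofReal_ne_top]
    exact ENNReal.mul_ne_top ENNReal.ofReal_ne_top hfin.ne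
  · refine Eventually.of_forall fun y => ?_
    refine (ENNReal.tendsto_ofReal ((hshift y).mul_const (f y))).congr' ?_
    filter_upwards [eventually_gt_atTop 0, hU' y] with t ht hy
    rw [Set.indicator_of_mem hy, ← ENNReal.ofReal_div_of_pos (hfx t ht), div_mul_eq_mul_div]

/-- The closed half-space and the reflected open one partition the space exactly, so the bisecting
hyperplane needs no separate treatment. -/
theorem tendsto_convSq_div {n : ℕ} {m β c₁ c₂ : ℝ} (hm : 0 < m) (hβ : 0 ≤ β) (hc₁ : 0 < c₁)
    (hc₂ : 0 < c₂) {f : EuclideanSpace ℝ (Fin n) → ℝ}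
    (hf : AEMeasurable f) (hnonneg : ∀ x, 0 ≤ f x)
    (hlow : ∀ x, x ≠ 0 → c₁ * expProfile m β ‖x‖ ≤ f x)
    (hup : ∀ x, x ≠ 0 → f x ≤ c₂ * expProfile m β ‖x‖)
    {θ : EuclideanSpace ℝ (Fin n)} (hθ : ‖θ‖ = 1) (hfin : dirExpMoment f θ m < ∞)
    (hshift : ∀ y, Tendsto (fun t : ℝ => f (t • θ - y) / f (t • θ)) atTop
      (𝓝 (Real.exp (m * inner ℝ θ y)))) :
    Tendsto (fun t : ℝ => convSq f (t • θ) / ENNReal.ofReal (f (t • θ))) atTop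
      (𝓝 (2 * dirExpMoment f θ m)) := by
  have hU' : ∀ y, ∀ᶠ t : ℝ in atTop, ‖y‖ < ‖t • θ - y‖ := fun y => by
    filter_upwards [eventually_gt_atTop (2 * ‖y‖)] with t ht
    have h1 := norm_sub_norm_le (t • θ) y
    rw [norm_smul, hθ, mul_one] at h1
    linarith [Real.le_norm_self t]
  have hle := tendsto_setLIntegral_conv hm hβ hc₁ hc₂ hf hnonneg hlow hup hθ hfin hshift
    (U := fun t => {y | ‖y‖ ≤ ‖t • θ - y‖})
    (fun t => measurableSet_le (by fun_prop) (by fun_prop)) (fun t y hy => hy)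
    (fun y => (hU' y).mono fun t ht => ht.le)
  have hlt := tendsto_setLIntegral_conv hm hβ hc₁ hc₂ hf hnonneg hlow hup hθ hfin hshift
    (U := fun t => {y | ‖y‖ < ‖t • θ - y‖})
    (fun t => measurableSet_lt (by fun_prop) (by fun_prop)) (fun t y hy => le_of_lt hy) hU'
  rw [two_mul]
  refine (hle.add hlt).congr' ?_
  filter_upwards [eventually_gt_atTop 0] with t ht
  have hfx : 0 < f (t • θ) := (mul_pos hc₁ (expProfile_pos _ _ _)).trans_le (hlow _
    (smul_ne_zero ht.ne' (norm_ne_zero_iff.1 (by rw [hθ]; exact one_ne_zero))))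
  have hcompl : {y | ‖y‖ ≤ ‖t • θ - y‖}ᶜ =
      (fun y => t • θ - y) ⁻¹' {y | ‖y‖ < ‖t • θ - y‖} := by
    ext y; simp
  rw [convSq, div_eq_mul_inv, ← lintegral_mul_const' _ _ (by simpa using hfx)]
  simp only [← div_eq_mul_inv]
  set G : EuclideanSpace ℝ (Fin n) → ℝ≥0∞ := fun y =>
    ENNReal.ofReal (f (t • θ - y) * f y) / ENNReal.ofReal (f (t • θ)) with hG
  have hrefl := setLIntegral_reflect (t • θ) G
    (fun y => by simp only [hG, sub_sub_cancel, mul_comm])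
    (measurableSet_lt (by fun_prop) (by fun_prop) : MeasurableSet {y | ‖y‖ < ‖t • θ - y‖})
  rw [← hrefl, ← hcompl]
  exact lintegral_add_compl G (measurableSet_le (by fun_prop) (by fun_prop))

/-- At every `y` one of the two opposite tilts is at least 1. -/
theorem integrable_of_dirExpMoment_lt_top {n : ℕ} {m : ℝ} {f : EuclideanSpace ℝ (Fin n) → ℝ}
    (hf : AEMeasurable f) (hnonneg : ∀ x, 0 ≤ f x) (θ : EuclideanSpace ℝ (Fin n))
    (h : dirExpMoment f θ m < ∞) (h' : dirExpMoment f (-θ) m < ∞) : Integrable f := by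
  refine ⟨hf.aestronglyMeasurable, ?_⟩
  rw [hasFiniteIntegral_iff_ofReal (Eventually.of_forall hnonneg)]
  refine lt_of_le_of_lt ?_ (ENNReal.add_lt_top.2 ⟨h, h'⟩)
  rw [dirExpMoment, dirExpMoment, ← lintegral_add_left' (by fun_prop)]
  refine lintegral_mono fun y => ?_
  rw [inner_neg_left, mul_neg]
  rcases le_total 0 (m * inner ℝ θ y) with h0 | h0
  · refine le_add_right (ENNReal.ofReal_le_ofReal (le_mul_of_one_le_left (hnonneg y) ?_))
    exact Real.one_le_exp h0
  · refine le_add_left (ENNReal.ofReal_le_ofReal (le_mul_of_one_le_left (hnonneg y) ?_))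
    exact Real.one_le_exp (by linarith)

/-! ### The theorem. -/

theorem proposition3 (d : ℕ) (hd : 1 ≤ d) (m β : ℝ) (hm : 0 < m) (hβ : 0 ≤ β)
    (η : EuclideanSpace ℝ (Fin d) → ℝ) (c₁ c₂ : ℝ) (hc₁ : 0 < c₁)
    (hη : ∀ u : EuclideanSpace ℝ (Fin d), ‖u‖ = 1 → c₁ ≤ η u ∧ η u ≤ c₂)
    (f : EuclideanSpace ℝ (Fin d) → ℝ)
    (hf_meas : AEMeasurable f volume)
    (hf_nonneg : ∀ x, 0 ≤ f x)
    (hf : ∀ x : EuclideanSpace ℝ (Fin d), x ≠ 0 →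
      f x = η (‖x‖⁻¹ • x) * expProfile m β ‖x‖) :
    (∀ θ : EuclideanSpace ℝ (Fin d), ‖θ‖ = 1 →
      (∀ y : EuclideanSpace ℝ (Fin d),
        Tendsto (fun t : ℝ => η (‖t • θ - y‖⁻¹ • (t • θ - y))) atTop (𝓝 (η θ))) →
      (MemConvEquiv θ m f ↔ ((d : ℝ) + 1) / 2 < β)) ∧
    (((d : ℝ) + 1) / 2 < β →
      ∃ c : ℝ, 1 ≤ c ∧ ∀ r : ℝ, 1 < r →
        ENNReal.ofReal (c⁻¹ * r ^ (((d : ℝ) + 1) / 2 - β)) ≤ convK f r ∧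
        convK f r ≤ ENNReal.ofReal (c * r ^ (((d : ℝ) + 1) / 2 - β))) ∧
    (β ≤ ((d : ℝ) + 1) / 2 → ∀ r : ℝ, 1 < r → convK f r = ∞) := by
  obtain ⟨n, rfl⟩ : ∃ n, d = n + 1 := ⟨d - 1, by omega⟩
  have hd' : (((n + 1 : ℕ) : ℝ) + 1) / 2 = ((n : ℝ) + 2) / 2 := by push_cast; ring
  rw [hd']
  have hunit : ∀ x : EuclideanSpace ℝ (Fin (n + 1)), x ≠ 0 → ‖‖x‖⁻¹ • x‖ = 1 := fun x hx => by
    rw [norm_smul, norm_inv, norm_norm, inv_mul_cancel₀ (norm_ne_zero_iff.2 hx)]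
  have hc₂ : 0 < c₂ := by
    have := hη (EuclideanSpace.single 0 1) (by simp)
    linarith
  have hlow : ∀ x, x ≠ 0 → c₁ * expProfile m β ‖x‖ ≤ f x := fun x hx => by
    rw [hf x hx]
    exact mul_le_mul_of_nonneg_right (hη _ (hunit x hx)).1 (expProfile_pos _ _ _).le
  have hup : ∀ x, x ≠ 0 → f x ≤ c₂ * expProfile m β ‖x‖ := fun x hx => by
    rw [hf x hx]
    exact mul_le_mul_of_nonneg_right (hη _ (hunit x hx)).2 (expProfile_pos _ _ _).le
  refine ⟨fun θ hθ hcont => ⟨fun h => ?_, fun hβ' => ?_⟩, fun hβ' => ?_, fun hβ' r hr => ?_⟩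
  -- Necessity uses only the finiteness of the moment.
  · by_contra hβ'
    exact h.moment_lt_top.ne (dirExpMoment_eq_top hm hβ hc₁ (not_lt.1 hβ') hlow hθ)
  · have hfin : ∀ u : EuclideanSpace ℝ (Fin (n + 1)), ‖u‖ = 1 → dirExpMoment f u m < ∞ :=
      fun u hu => dirExpMoment_lt_top hm hβ hc₂ hβ' hup hu
    have hx0 : ∀ t : ℝ, 0 < t → t • θ ≠ 0 := fun t ht =>
      smul_ne_zero ht.ne' (norm_ne_zero_iff.1 (by rw [hθ]; exact one_ne_zero))
    have hθη : 0 < η θ := hc₁.trans_le (hη θ hθ).1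
    have hshift : ∀ y, Tendsto (fun t : ℝ => f (t • θ - y) / f (t • θ)) atTop
        (𝓝 (Real.exp (m * inner ℝ θ y))) := fun y => by
      have h := ((hcont y).div_const (η θ)).mul (tendsto_expProfile_div m β hθ y)
      rw [div_self hθη.ne', one_mul] at h
      refine h.congr' ?_
      filter_upwards [eventually_gt_atTop ‖y‖] with t ht
      have ht0 : 0 < t := (norm_nonneg y).trans_lt ht
      have hnt : ‖t • θ‖ = t := by rw [norm_smul, hθ, mul_one, Real.norm_of_nonneg ht0.le]
      have hz0 : t • θ - y ≠ 0 := fun h0 => by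
        rw [← sub_eq_zero.1 h0, hnt] at ht
        exact ht.false
      rw [hf _ hz0, hf _ (hx0 t ht0), hnt, smul_smul, inv_mul_cancel₀ ht0.ne', one_smul,
        mul_div_mul_comm]
    exact
      { norm_eq_one := hθ
        gamma_nonneg := hm.le
        nonneg := hf_nonneg
        integrable := integrable_of_dirExpMoment_lt_top hf_meas hf_nonneg θ (hfin θ hθ)
          (hfin (-θ) (by rwa [norm_neg]))
        pos_on_ray := ⟨1, one_pos, fun t ht =>
          (mul_pos hc₁ (expProfile_pos _ _ _)).trans_le (hlow _ (hx0 t (by linarith)))⟩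
        tendsto_shift := hshift
        moment_lt_top := hfin θ hθ
        tendsto_conv := tendsto_convSq_div hm hβ hc₁ hc₂ hf_meas hf_nonneg hlow hup hθ
          (hfin θ hθ) hshift }
  · exact exists_convK_bounds hm hβ hc₁ hc₂ hβ' hf_nonneg hlow hup
  · exact convK_eq_top hm hβ hc₁ hc₂ hβ' hlow hup hr
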